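/- Let $d\ge 1$, $L>0$, $\alpha>0$. Consider laws $\mathbb P_{(X,Y)}$ on $\mathbb R^d\times\{0,1\}$ such that $X$ has a Lebesgue density $\mu$ with $\Omega:=\{\mu>0\}$ open, and let $\eta(x)=\mathbb P(Y=1\mid X=x)$ for $x\in\Omega$. Write $|\cdot|$ for the Euclidean norm, $B(x,\delta)$ for the open Euclidean ball, $\gamma_d$ for the volume of the unit ball, and consider the following classes of laws. * $\mathcal F_{L,\alpha}$: $|\eta(x_1)-\eta(x_2)|\le L|x_1-x_2|$ for all $x_1,x_2\in\Omega$ (A1), and there is $C>0$ such that $\mathbb P_X(0<|\eta(X)-\tfrac12|<t)\le C t^{\alpha}$ for all $t>0$ (A2). * $\mathfrak M_{mma}(\Omega,\kappa)$: there is $\delta_0>0$ such that $\mathbb P_X(B(x,\delta))\ge\kappa\,\mu(x)\,\delta^d$ for all $0<\delta\le\delta_0$ and $x\in\Omega$ (A3). * $\mathcal P_{\mathcal T,Id}$: there is $\epsilon_0>0$ such that $\mathbb P_X(\mu<t)\le t$ for all $0<t<\epsilon_0$ (A4 with $\psi=Id$). A discrimination rule $\Phi_n$ is a $\{0,1\}$-valued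 jointly measurable function of a sample of size $n$ and of a point of $\mathbb R^d$. Its risk $\mathcal R(\Phi_n)$ is the probability, over an i.i.d. sample $(X_1,Y_1),\dots,(X_n,Y_n)$ and an independent pair $(X,Y)$ of the same law, that $\Phi_n$ predicts $Y$ wrongly at $X$. Let $\Phi^*=\mathbf 1_{\{\eta>1/2\}}$ be the Bayes classifier. Call a sequence $(\Phi_n)_n$ of rules uniformly consistent over a class of laws if the supremum over the class of $\mathcal R(\Phi_n)-\mathcal R(\Phi^*)$ tends to $0$ as $n\to\infty$. (i) (A1–A3 without A4.) Let $0<\kappa<\gamma_d$. There are $C>0$ and $\delta_0>0$ such that, for every $n$, every rule $\Phi_n$ and every $\epsilon<\min(4^{-\alpha},\tfrac12)$, some law in $\mathcal F_{L,\alpha}\cap\mathfrak M_{mma}(\Omega,\kappa)$, satisfying A2 with this $C$ and A3 with this $\delta_0$, gives $$\mathcal R(\Phi_n)-\mathcal R(\Phi^*)\ge\epsilon .$$ Moreover, no sequence of rules is uniformly consistent over the laws of $\mathcal F_{L,\alpha}\cap\mathfrak M_{mma}(\Omega,\kappa)$ that satisfy A2 with this $C$ and A3 with this $\delta_0$. (ii)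 (A1, A2, A4 without A3.) There are $C>0$ and $\epsilon_0>0$ such that, for every $n$, every rule $\Phi_n$ and every $\epsilon<\min(4^{-\alpha},\tfrac12)$, some law in $\mathcal F_{L,\alpha}\cap\mathcal P_{\mathcal T,Id}$, satisfying A2 with this $C$ and A4 with this $\epsilon_0$, gives $$\mathcal R(\Phi_n)-\mathcal R(\Phi^*)\ge\epsilon .$$ Moreover, no sequence of rules is uniformly consistent over the laws of $\mathcal F_{L,\alpha}\cap\mathcal P_{\mathcal T,Id}$ that satisfy A2 with this $C$ and A4 with this $\epsilon_0$. -/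

import Mathlib

open MeasureTheory

/-- `ℝ^d` with its Euclidean norm. -/
abbrev Feat (d : ℕ) : Type := EuclideanSpace ℝ (Fin d)

/-- The law of a pair `(X, Y)` in `ℝ^d × {0, 1}` (label `1` is `true`, label `0` is `false`), together
with a version `μ` of the Lebesgue density of `X`, for which `Ω = {μ > 0}` is open, and a version `η`
of the regression function `x ↦ P(Y = 1 | X = x)` on `Ω`. -/
structure ClassLaw (d : ℕ) where
  law : Measure (Feat d × Bool)
  isProb : IsProbabilityMeasure law
  μ : Feat d → ℝ
  η : Feat d → ℝ
  μ_measurable : Measurable μ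
  μ_nonneg : ∀ x, 0 ≤ μ x
  isOpen_support : IsOpen (Function.support μ)
  η_measurable : Measurable η
  η_mem : ∀ x ∈ Function.support μ, η x ∈ Set.Icc (0 : ℝ) 1
  marginal_eq : law.map Prod.fst = volume.withDensity (fun x => ENNReal.ofReal (μ x))
  regression_eq : ∀ A : Set (Feat d), MeasurableSet A →
    law (A ×ˢ {true}) = ∫⁻ x in A, ENNReal.ofReal (η x) ∂(law.map Prod.fst)

namespace ClassLaw

variable {d : ℕ}

/-- The domain `Ω = {μ > 0}`. -/
def Ω (P : ClassLaw d) : Set (Feat d) := Function.support P.μ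

/-- The marginal law of `X`. -/
noncomputable def lawX (P : ClassLaw d) : Measure (Feat d) := P.law.map Prod.fst

/-- `η` is `L`-Lipschitz on `Ω`. -/
def IsSmooth (P : ClassLaw d) (L : ℝ) : Prop :=
  ∀ x₁ ∈ P.Ω, ∀ x₂ ∈ P.Ω, |P.η x₁ - P.η x₂| ≤ L * ‖x₁ - x₂‖

/-- The margin inequality with exponent `α` and constant `C`. -/
def HasMargin (P : ClassLaw d) (α C : ℝ) : Prop :=
  ∀ ε : ℝ, 0 < ε → P.lawX.real {x | 0 < |P.η x - 1 / 2| ∧ |P.η x - 1 / 2| < ε} ≤ C * ε ^ α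

/-- The strong minimal mass inequality with constant `κ` for all radii up to `δ₀`. -/
def HasMinimalMass (P : ClassLaw d) (κ δ₀ : ℝ) : Prop :=
  ∀ δ : ℝ, 0 < δ → δ ≤ δ₀ → ∀ x ∈ P.Ω, κ * P.μ x * δ ^ d ≤ P.lawX.real (Metric.ball x δ)

/-- The tail inequality with function `ψ` for all levels below `ε₀`. -/
def HasTail (P : ClassLaw d) (ψ : ℝ → ℝ) (ε₀ : ℝ) : Prop :=
  ∀ ε : ℝ, 0 < ε → ε < ε₀ → P.lawX.real {x | P.μ x < ε} ≤ ψ ε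

/-- The Bayes classifier `1_{η > 1/2}`. -/
noncomputable def bayes (P : ClassLaw d) (x : Feat d) : Bool := decide (1 / 2 < P.η x)

/-- The misclassification error of the Bayes classifier. -/
noncomputable def bayesRisk (P : ClassLaw d) : ℝ := P.law.real {z | P.bayes z.1 ≠ z.2}

/-- The misclassification error of the rule `Φ` built on an i.i.d. sample of size `n`: the probability
of error on a new independent pair, over the sample and the new pair together. -/
noncomputable def risk (P : ClassLaw d) {n : ℕ}
    (Φ : (Fin n → Feat d × Bool) → Feat d → Bool) : ℝ :=
  ((Measure.pi fun _ : Fin n => P.law).prod P.law).real {w | Φ w.1 w.2.1 ≠ w.2.2}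

/-- The excess risk of the rule `Φ` over the Bayes classifier. -/
noncomputable def excessRisk (P : ClassLaw d) {n : ℕ}
    (Φ : (Fin n → Feat d × Bool) → Feat d → Bool) : ℝ :=
  P.risk Φ - P.bayesRisk

end ClassLaw

/-- The class `F_{L,α}`: smoothness with radius `L` and margin with exponent `α`. -/
def smoothMarginClass (d : ℕ) (L α : ℝ) : Set (ClassLaw d) :=
  {P | P.IsSmooth L ∧ ∃ C > 0, P.HasMargin α C}

/-- The class `M_mma(Ω, κ)` of laws with the strong minimal mass property. -/
def minimalMassClass (d : ℕ) (κ : ℝ) : Set (ClassLaw d) :=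
  {P | ∃ δ₀ > 0, P.HasMinimalMass κ δ₀}

/-- The class `P_{T,ψ}` of laws with the tail property. -/
def tailClass (d : ℕ) (ψ : ℝ → ℝ) : Set (ClassLaw d) :=
  {P | ∃ ε₀ > 0, P.HasTail ψ ε₀}

/-- A discrimination rule of sample size `n`: a classifier that depends, jointly measurably, on the
sample and on the point to be classified. -/
structure DiscRule (d n : ℕ) where
  toFun : (Fin n → Feat d × Bool) → Feat d → Bool
  measurable : Measurable (Function.uncurry toFun)

/-- The excess risk of the rules `Φ n` tends to `0` uniformly over the class `S`. -/
def UniformlyConsistent {d : ℕ} (S : Set (ClassLaw d)) (Φ : ∀ n : ℕ, DiscRule d n) : Prop :=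
  ∀ ε : ℝ, 0 < ε → ∃ N : ℕ, ∀ n ≥ N, ∀ P ∈ S, P.excessRisk (Φ n).toFun < ε

/-!
The labels of the hard laws are a deterministic function of `X`, so the Bayes risk is `0`, and `η`
only takes the values `0` and `1`, so the margin condition holds with constant `2 ^ α`. The law of `X`
is the uniform mixture of `m` translates of a bump along one axis (`translateMixture`), spaced so that
the supports are at least `1 / L` apart. Any labelling of the translates is then `L`-Lipschitz
on `Ω` (`ClassLaw.isSmooth_ofLabelling`).

A new point falls outside the translates visited by a sample of size `n` with probability at least
`1 - n / m`, and there the sample says nothing about the label. Averaged over all labellings, every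
rule is thus wrong with probability at least `(1 - n / m) / 2` (`exists_labelling_le_error`), and some
labelling does at least as badly as the average. For large `m` the excess risk exceeds any level below
`1 / 2`. Since `C` is chosen once for all laws, the bound `4 ^ (-α)` on the level is not a constraint
for this construction.

It remains to choose the bump.

* Minimal mass: the density must have averages over small balls that are at least almost its value at
  the centre, even near the boundary of its support. The bump `cosBump` satisfies
  `φ (x + y) + φ (x - y) ≥ 2 c φ x` for `‖y‖ < δ`, with `c` close to `1` for small `δ`, by the addition
  formula for the cosine. Such inequalities for symmetric pairs are stable under translates and sums,
  so the radius `δ₀` does not depend on `m`. The mixture has low density for large `m`, hence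
  violates the tail condition uniformly.
* Tail: `m` balls of radius `1 / m` carry a uniform density that is bounded below independently of
  `m`, so it has no mass at low levels. Here the radii tend to `0` with `m`, and minimal mass fails
  uniformly.
-/

/-! ### Random labelling of unseen cells -/

/-- Pairing each labelling of the cells with the one that differs from it at the cell `j` alone: a
prediction for the label of `j` that does not look at the label of `j` is wrong for exactly one of
the two, hence for half of all labellings. -/
theorem sum_indicator_ne_of_update_eq {ι : Type*} [Fintype ι] [DecidableEq ι]
    (f : (ι → Bool) → Bool) (j : ι) (hf : ∀ σ, f (Function.update σ j (!σ j)) = f σ) :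
    ∑ σ : ι → Bool, (if f σ ≠ σ j then (1 : ℝ) else 0) = Fintype.card (ι → Bool) / 2 := by
  let e : (ι → Bool) → (ι → Bool) := fun σ => Function.update σ j (!σ j)
  have he : Function.Involutive e := by
    intro σ
    simp [e]
  have h1 : ∑ σ : ι → Bool, (if f σ ≠ σ j then (1 : ℝ) else 0) =
      ∑ σ : ι → Bool, (if f σ ≠ !σ j then (1 : ℝ) else 0) := by
    rw [← Equiv.sum_comp (he.toPerm e)]
    refine Finset.sum_congr rfl fun σ _ => ?_
    have h : f (e σ) = f σ := hf σ
    have h' : e σ j = !σ j := Function.update_self ..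
    simp only [Function.Involutive.coe_toPerm, h, h']
  have h2 : ∑ σ : ι → Bool, (if f σ ≠ σ j then (1 : ℝ) else 0) +
      ∑ σ : ι → Bool, (if f σ ≠ !σ j then (1 : ℝ) else 0) = Fintype.card (ι → Bool) := by
    rw [← Finset.sum_add_distrib, ← Finset.card_univ, Finset.card_eq_sum_ones, Nat.cast_sum]
    refine Finset.sum_congr rfl fun σ _ => ?_
    cases f σ <;> cases σ j <;> simp
  linarith

section Labelling

variable {E ι : Type*} [MeasurableSpace E] [Fintype ι] [MeasurableSpace ι]
  [MeasurableSingletonClass ι]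

/-- A fresh point falls into a cell already visited by the sample with probability at most `n * p`,
if every cell has probability at most `p`. -/
theorem one_sub_le_measureReal_unseen (ν : Measure E) [IsProbabilityMeasure ν] {k : E → ι}
    (hk : Measurable k) {p : ℝ} (hp : ∀ j, ν.real (k ⁻¹' {j}) ≤ p) (n : ℕ) :
    1 - n * p ≤ ((Measure.pi fun _ : Fin n => ν).prod ν).real {w | ∀ i, k (w.1 i) ≠ k w.2} := by
  set M := (Measure.pi fun _ : Fin n => ν).prod ν
  have hm : ∀ i : Fin n, MeasurableSet {w : (Fin n → E) × E | k (w.1 i) = k w.2} := fun i =>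
    measurableSet_eq_fun (by fun_prop) (by fun_prop)
  have hp0 : 0 ≤ p := by
    obtain ⟨x⟩ : Nonempty E := nonempty_of_isProbabilityMeasure ν
    exact measureReal_nonneg.trans (hp (k x))
  have hi : ∀ i : Fin n, M.real {w | k (w.1 i) = k w.2} ≤ p := by
    intro i
    refine ENNReal.toReal_le_of_le_ofReal hp0 ?_
    rw [Measure.prod_apply (hm i)]
    calc _ ≤ ∫⁻ _, ENNReal.ofReal p ∂(Measure.pi fun _ : Fin n => ν) := by
          refine lintegral_mono fun x => ?_
          rw [show Prod.mk x ⁻¹' {w : (Fin n → E) × E | k (w.1 i) = k w.2} = k ⁻¹' {k (x i)} by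
            ext y; simp [eq_comm]]
          exact (ENNReal.le_ofReal_iff_toReal_le (measure_ne_top _ _) hp0).2 (hp _)
      _ = _ := by simp
  have hc : {w : (Fin n → E) × E | ∀ i, k (w.1 i) ≠ k w.2} =
      (⋃ i, {w : (Fin n → E) × E | k (w.1 i) = k w.2})ᶜ := by
    ext w; simp
  rw [hc, probReal_compl_eq_one_sub (MeasurableSet.iUnion hm)]
  have := calc M.real (⋃ i, {w : (Fin n → E) × E | k (w.1 i) = k w.2})
      ≤ ∑ i, M.real {w | k (w.1 i) = k w.2} := measureReal_iUnion_fintype_le _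
    _ ≤ ∑ _i : Fin n, p := Finset.sum_le_sum fun i _ => hi i
    _ = n * p := by simp
  linarith

/-- Averaging over all labellings of the cells: some labelling makes the rule err with probability
at least one half of the probability that the new point falls into a cell without sample points. -/
theorem exists_labelling_le_error (ν : Measure E) [IsProbabilityMeasure ν] {k : E → ι}
    (hk : Measurable k) {p : ℝ} (hp : ∀ j, ν.real (k ⁻¹' {j}) ≤ p) {n : ℕ}
    {Φ : (Fin n → E × Bool) → E → Bool} (hΦ : Measurable (Function.uncurry Φ)) :
    ∃ σ : ι → Bool, (1 - n * p) / 2 ≤ ((Measure.pi fun _ : Fin n => ν).prod ν).real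
      {w | Φ (fun i => (w.1 i, σ (k (w.1 i)))) w.2 ≠ σ (k w.2)} := by
  classical
  set M := (Measure.pi fun _ : Fin n => ν).prod ν
  set A : (ι → Bool) → Set ((Fin n → E) × E) :=
    fun σ => {w | Φ (fun i => (w.1 i, σ (k (w.1 i)))) w.2 ≠ σ (k w.2)} with hA
  set G : Set ((Fin n → E) × E) := {w | ∀ i, k (w.1 i) ≠ k w.2} with hG
  have hσ : ∀ σ : ι → Bool, Measurable σ := fun σ => measurable_of_finite σ
  have hAm : ∀ σ, MeasurableSet (A σ) := by
    intro σ
    have h1 : Measurable fun w : (Fin n → E) × E => Φ (fun i => (w.1 i, σ (k (w.1 i)))) w.2 := by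
      refine hΦ.comp (Measurable.prodMk (measurable_pi_lambda _ fun i => ?_) measurable_snd)
      have := hσ σ
      fun_prop
    exact (measurableSet_eq_fun h1 ((hσ σ).comp (hk.comp measurable_snd))).compl
  have hGm : MeasurableSet G := by
    have : G = ⋂ i, {w : (Fin n → E) × E | k (w.1 i) = k w.2}ᶜ := by ext w; simp [hG]
    rw [this]
    exact MeasurableSet.iInter fun i => (measurableSet_eq_fun (by fun_prop) (by fun_prop)).compl
  by_contra! hlt
  set N : ℝ := (Fintype.card (ι → Bool) : ℝ) with hN
  have hN0 : 0 < N := by simp [hN]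
  have hint : ∀ s : Set ((Fin n → E) × E), MeasurableSet s →
      Integrable (s.indicator (1 : (Fin n → E) × E → ℝ)) M := fun s hs =>
    (integrable_const (1 : ℝ)).indicator hs
  have h1 : N / 2 * M.real G ≤ ∑ σ, M.real (A σ) := by
    simp_rw [← integral_indicator_one hGm, ← integral_indicator_one (hAm _)]
    rw [← integral_finsetSum _ (fun σ _ => hint _ (hAm σ)), ← integral_const_mul]
    refine integral_mono ((hint _ hGm).const_mul _)
      (integrable_finsetSum _ fun σ _ => hint _ (hAm σ)) fun w => ?_
    by_cases hw : w ∈ G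
    · have := sum_indicator_ne_of_update_eq
        (fun σ => Φ (fun i => (w.1 i, σ (k (w.1 i)))) w.2) (k w.2) (fun σ => by
          have hwi : ∀ i, k (w.1 i) ≠ k w.2 := hw
          simp [Function.update_of_ne (hwi _)])
      simp only [Set.indicator_of_mem hw, Pi.one_apply, mul_one]
      rw [hN, ← this]
      refine Finset.sum_le_sum fun σ _ => le_of_eq ?_
      simp [Set.indicator_apply, hA]
    · simp only [Set.indicator_of_notMem hw, mul_zero]
      exact Finset.sum_nonneg fun σ _ => Set.indicator_nonneg (fun _ _ => zero_le_one) _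
  have h2 : ∑ σ, M.real (A σ) < ∑ _σ : ι → Bool, (1 - n * p) / 2 :=
    Finset.sum_lt_sum_of_nonempty Finset.univ_nonempty fun σ _ => hlt σ
  have h3 := one_sub_le_measureReal_unseen ν hk hp n
  have h4 : ∑ _σ : ι → Bool, (1 - n * p) / 2 = N / 2 * (1 - n * p) := by
    simp only [Finset.sum_const, nsmul_eq_mul, Finset.card_univ, ← hN]; ring
  nlinarith [mul_le_mul_of_nonneg_left h3 (half_pos hN0).le]

end Labelling

/-! ### Laws with deterministic labels -/

variable {d : ℕ}

/-- The law of `(X, σ (k X))`, where `X` has density `μ` and `k` assigns to each point its cell: the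
label is a function of the cell, so that the regression function only takes the values `0` and `1`. -/
noncomputable def ClassLaw.ofLabelling {ι : Type*} [Finite ι] [MeasurableSpace ι]
    [MeasurableSingletonClass ι] (μ : Feat d → ℝ) (hμ : Measurable μ) (hμ0 : ∀ x, 0 ≤ μ x)
    (hμo : IsOpen (Function.support μ)) (hμ1 : ∫⁻ x, ENNReal.ofReal (μ x) = 1)
    (k : Feat d → ι) (hk : Measurable k) (σ : ι → Bool) : ClassLaw d where
  law := (volume.withDensity fun x => ENNReal.ofReal (μ x)).map fun x => (x, σ (k x))
  isProb := by
    have : IsProbabilityMeasure (volume.withDensity fun x => ENNReal.ofReal (μ x)) :=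
      ⟨by rw [withDensity_apply _ MeasurableSet.univ, setLIntegral_univ, hμ1]⟩
    exact Measure.isProbabilityMeasure_map
      (measurable_id.prodMk ((measurable_of_finite σ).comp hk)).aemeasurable
  μ := μ
  η := fun x => if σ (k x) = true then 1 else 0
  μ_measurable := hμ
  μ_nonneg := hμ0
  isOpen_support := hμo
  η_measurable := (measurable_of_finite fun j => if σ j = true then (1 : ℝ) else 0).comp hk
  η_mem := fun x _ => by split_ifs <;> simp
  marginal_eq := by
    have hm : Measurable fun x : Feat d => (x, σ (k x)) :=
      measurable_id.prodMk ((measurable_of_finite σ).comp hk)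
    rw [Measure.map_map measurable_fst hm]
    exact Measure.map_id
  regression_eq := fun A hA => by
    have hm : Measurable fun x : Feat d => (x, σ (k x)) :=
      measurable_id.prodMk ((measurable_of_finite σ).comp hk)
    have hs : MeasurableSet {x : Feat d | σ (k x) = true} :=
      (measurable_of_finite σ).comp hk (measurableSet_singleton true)
    rw [Measure.map_map measurable_fst hm, Measure.map_apply hm (hA.prod (measurableSet_singleton _)),
      show Prod.fst ∘ (fun x : Feat d => (x, σ (k x))) = id from rfl, Measure.map_id]
    have : ∀ x : Feat d, ENNReal.ofReal (if σ (k x) = true then 1 else 0) =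
        {x : Feat d | σ (k x) = true}.indicator 1 x := by
      intro x
      by_cases h : σ (k x) = true <;> simp [h]
    simp_rw [this]
    rw [lintegral_indicator_one hs, Measure.restrict_apply hs]
    congr 1
    ext x
    simp [and_comm]

section OfLabelling

variable {ι : Type*} [Finite ι] [MeasurableSpace ι] [MeasurableSingletonClass ι]
  {μ : Feat d → ℝ} {hμ : Measurable μ} {hμ0 : ∀ x, 0 ≤ μ x} {hμo : IsOpen (Function.support μ)}
  {hμ1 : ∫⁻ x, ENNReal.ofReal (μ x) = 1} {k : Feat d → ι} {hk : Measurable k} {σ : ι → Bool}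

open ClassLaw

theorem ClassLaw.lawX_apply (P : ClassLaw d) {s : Set (Feat d)} (hs : MeasurableSet s) :
    P.lawX s = ∫⁻ x in s, ENNReal.ofReal (P.μ x) := by
  rw [lawX, P.marginal_eq, withDensity_apply _ hs]

instance ClassLaw.isProbabilityMeasure_lawX (P : ClassLaw d) : IsProbabilityMeasure P.lawX :=
  have := P.isProb
  Measure.isProbabilityMeasure_map measurable_fst.aemeasurable

/-- Labels that are a function of the point are predicted without error by the Bayes classifier. -/
theorem ClassLaw.bayesRisk_ofLabelling :
    (ofLabelling μ hμ hμ0 hμo hμ1 k hk σ).bayesRisk = 0 := by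
  have hm : Measurable fun x : Feat d => (x, σ (k x)) :=
    measurable_id.prodMk ((measurable_of_finite σ).comp hk)
  have hb : ∀ x, (ofLabelling μ hμ hμ0 hμo hμ1 k hk σ).bayes x = σ (k x) := by
    intro x
    simp only [bayes, ofLabelling]
    by_cases h : σ (k x) = true <;> norm_num [h]
  have hs : MeasurableSet {z : Feat d × Bool | σ (k z.1) ≠ z.2} :=
    (measurableSet_eq_fun ((measurable_of_finite σ).comp (hk.comp measurable_fst))
      measurable_snd).compl
  simp only [bayesRisk, hb]
  rw [ofLabelling, map_measureReal_apply hm hs]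
  simp

theorem ClassLaw.risk_ofLabelling {n : ℕ} {Φ : (Fin n → Feat d × Bool) → Feat d → Bool}
    (hΦ : Measurable (Function.uncurry Φ)) :
    (ofLabelling μ hμ hμ0 hμo hμ1 k hk σ).risk Φ =
      ((Measure.pi fun _ : Fin n => volume.withDensity fun x => ENNReal.ofReal (μ x)).prod
        (volume.withDensity fun x => ENNReal.ofReal (μ x))).real
      {w | Φ (fun i => (w.1 i, σ (k (w.1 i)))) w.2 ≠ σ (k w.2)} := by
  have hm : Measurable fun x : Feat d => (x, σ (k x)) :=
    measurable_id.prodMk ((measurable_of_finite σ).comp hk)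
  have : IsProbabilityMeasure (volume.withDensity fun x => ENNReal.ofReal (μ x)) :=
    ⟨by rw [withDensity_apply _ MeasurableSet.univ, setLIntegral_univ, hμ1]⟩
  have : IsProbabilityMeasure ((volume.withDensity fun x => ENNReal.ofReal (μ x)).map
      fun x => (x, σ (k x))) := Measure.isProbabilityMeasure_map hm.aemeasurable
  have hs : MeasurableSet {w : (Fin n → Feat d × Bool) × (Feat d × Bool) |
      Φ w.1 w.2.1 ≠ w.2.2} :=
    (measurableSet_eq_fun (hΦ.comp (measurable_fst.prodMk (measurable_fst.comp measurable_snd)))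
      (measurable_snd.comp measurable_snd)).compl
  have hm' : Measurable fun (x : Fin n → Feat d) (i : Fin n) => (x i, σ (k (x i))) :=
    measurable_pi_lambda _ fun i => hm.comp (measurable_pi_apply i)
  rw [risk, ofLabelling, ← Measure.pi_map_pi (fun _ => hm.aemeasurable),
    Measure.map_prod_map _ _ hm' hm, map_measureReal_apply (hm'.prodMap hm) hs]
  rfl

/-- The margin function `|η - 1/2|` is constantly `1/2`, so every exponent is admissible, with the
constant `2 ^ α`. -/
theorem ClassLaw.hasMargin_ofLabelling {α : ℝ} (hα : 0 < α) :
    (ofLabelling μ hμ hμ0 hμo hμ1 k hk σ).HasMargin α (2 ^ α) := by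
  intro ε hε
  set P := ofLabelling μ hμ hμ0 hμo hμ1 k hk σ
  have habs : ∀ x, |P.η x - 1 / 2| = 1 / 2 := by
    intro x
    simp only [P, ofLabelling]
    split_ifs <;> norm_num [abs_of_pos, abs_of_neg]
  rw [← Real.mul_rpow zero_le_two hε.le]
  rcases le_or_gt ε (1 / 2) with h | h
  · have : {x | 0 < |P.η x - 1 / 2| ∧ |P.η x - 1 / 2| < ε} = ∅ := by
      ext x
      simp only [habs, Set.mem_ofPred_eq, Set.mem_empty_iff_false, iff_false, not_and, not_lt]
      exact fun _ => h
    rw [this, measureReal_empty]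
    positivity
  · exact measureReal_le_one.trans (Real.one_le_rpow (by linarith) hα.le)

/-- If distinct cells of the support are at distance at least `1 / L`, labels constant on the cells
are `L`-Lipschitz. -/
theorem ClassLaw.isSmooth_ofLabelling {L : ℝ} (hL : 0 < L)
    (hsep : ∀ x ∈ Function.support μ, ∀ y ∈ Function.support μ, k x ≠ k y → 1 / L ≤ ‖x - y‖) :
    (ofLabelling μ hμ hμ0 hμo hμ1 k hk σ).IsSmooth L := by
  intro x hx y hy
  by_cases h : k x = k y
  · simp only [ofLabelling, h, sub_self, abs_zero]
    positivity
  · refine le_trans ?_ ((div_le_iff₀' hL).1 (hsep x hx y hy h))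
    simp only [ofLabelling]
    split_ifs <;> norm_num

end OfLabelling

/-! ### Mixtures of translates of a bump -/

/-- The uniform mixture of the `m` translates of `φ` by `0, s, …, (m - 1) s` along the axis `i`. -/
noncomputable def translateMixture (i : Fin d) (s : ℝ) (m : ℕ) (φ : Feat d → ℝ) (x : Feat d) : ℝ :=
  (m : ℝ)⁻¹ * ∑ j : Fin m, φ (x - EuclideanSpace.single i (j * s))

/-- The number of the slab of width `s`, centred at a multiple of `s` on the axis `i`, that contains
`x`. Points outside the slabs `0, …, m - 1` get an arbitrary value. -/
noncomputable def slabIndex (i : Fin d) (s : ℝ) (m : ℕ) [NeZero m] (x : Feat d) : Fin m :=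
  Fin.ofNat m ⌊x i / s + 1 / 2⌋₊

section Mixture

variable {i : Fin d} {s : ℝ} {m : ℕ} {φ : Feat d → ℝ}

theorem measurable_slabIndex [NeZero m] : Measurable (slabIndex i s m) := by
  have h : Measurable fun x : Feat d => ⌊x i / s + 1 / 2⌋₊ := by
    refine Nat.measurable_floor.comp (Measurable.add_const (Measurable.div_const ?_ _) _)
    exact (EuclideanSpace.proj (𝕜 := ℝ) i).continuous.measurable
  exact (measurable_of_countable (Fin.ofNat m)).comp h

theorem slabIndex_eq [NeZero m] {a : ℝ} (has : 2 * a ≤ s) {x : Feat d} {j : Fin m}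
    (hx : |(x - EuclideanSpace.single i (j * s)) i| < a) : slabIndex i s m x = j := by
  have ha : 0 < a := (abs_nonneg _).trans_lt hx
  have hs : 0 < s := by linarith
  simp only [PiLp.sub_apply, PiLp.single_apply, if_true] at hx
  obtain ⟨h1, h2⟩ := abs_lt.1 hx
  have : ⌊x i / s + 1 / 2⌋₊ = (j : ℕ) := by
    have e : x i / s + 1 / 2 = j + ((x i - j * s) + s / 2) / s := by field_simp; ring
    have h3 : 0 ≤ ((x i - j * s) + s / 2) / s := div_nonneg (by linarith) hs.le
    have h4 : ((x i - j * s) + s / 2) / s < 1 := (div_lt_one hs).2 (by linarith)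
    rw [Nat.floor_eq_iff (by rw [e]; positivity), e]
    constructor <;> linarith
  rw [slabIndex, this]
  exact Fin.ofNat_val_eq_self j

theorem measurable_translateMixture (hφ : Measurable φ) :
    Measurable (translateMixture i s m φ) :=
  (Finset.measurable_fun_sum _ fun _ _ => hφ.comp (measurable_id.sub_const _)).const_mul _

theorem translateMixture_nonneg (hφ0 : ∀ x, 0 ≤ φ x) (x : Feat d) :
    0 ≤ translateMixture i s m φ x :=
  mul_nonneg (by positivity) (Finset.sum_nonneg fun _ _ => hφ0 _)

theorem translateMixture_ne_zero_iff (hm : m ≠ 0) (hφ0 : ∀ x, 0 ≤ φ x) (x : Feat d) :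
    translateMixture i s m φ x ≠ 0 ↔ ∃ j : Fin m, φ (x - EuclideanSpace.single i (j * s)) ≠ 0 := by
  rw [translateMixture, mul_ne_zero_iff,
    ne_eq (∑ j : Fin m, _), Finset.sum_eq_zero_iff_of_nonneg fun _ _ => hφ0 _]
  simp [hm]

theorem isOpen_support_translateMixture (hm : m ≠ 0) (hφ0 : ∀ x, 0 ≤ φ x)
    (hφo : IsOpen (Function.support φ)) :
    IsOpen (Function.support (translateMixture i s m φ)) := by
  have : Function.support (translateMixture i s m φ) =
      ⋃ j : Fin m, (fun x => x - EuclideanSpace.single i (j * s)) ⁻¹' Function.support φ := by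
    ext x
    simp [translateMixture_ne_zero_iff hm hφ0]
  rw [this]
  exact isOpen_iUnion fun j => hφo.preimage (by fun_prop)

theorem ofReal_translateMixture (hφ0 : ∀ x, 0 ≤ φ x) (x : Feat d) :
    ENNReal.ofReal (translateMixture i s m φ x) = ENNReal.ofReal (m : ℝ)⁻¹ *
      ∑ j : Fin m, ENNReal.ofReal (φ (x - EuclideanSpace.single i (j * s))) := by
  rw [translateMixture, ENNReal.ofReal_mul (by positivity),
    ENNReal.ofReal_sum_of_nonneg fun _ _ => hφ0 _]

theorem lintegral_translateMixture (hm : m ≠ 0) (hφ : Measurable φ) (hφ0 : ∀ x, 0 ≤ φ x)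
    (hφ1 : ∫⁻ x, ENNReal.ofReal (φ x) = 1) :
    ∫⁻ x, ENNReal.ofReal (translateMixture i s m φ x) = 1 := by
  simp_rw [ofReal_translateMixture hφ0]
  have hmeas : ∀ z : Feat d, Measurable fun x => ENNReal.ofReal (φ (x - z)) := fun z =>
    (hφ.comp (measurable_id.sub_const z)).ennreal_ofReal
  rw [lintegral_const_mul _ (Finset.measurable_fun_sum _ fun _ _ => hmeas _),
    lintegral_finsetSum _ fun _ _ => hmeas _]
  simp_rw [lintegral_sub_right_eq_self (fun x => ENNReal.ofReal (φ x)), hφ1]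
  have : (0 : ℝ) < m := by positivity
  rw [ENNReal.ofReal_inv_of_pos this]
  simp [ENNReal.inv_mul_cancel, hm]

/-- A slab carries the mass of one translate only. -/
theorem setLIntegral_translateMixture_le [NeZero m] {a : ℝ} (has : 2 * a ≤ s)
    (hφ0 : ∀ x, 0 ≤ φ x) (hφ1 : ∫⁻ x, ENNReal.ofReal (φ x) = 1)
    (hφa : ∀ x, φ x ≠ 0 → |x i| < a) (j : Fin m) :
    ∫⁻ x in slabIndex i s m ⁻¹' {j}, ENNReal.ofReal (translateMixture i s m φ x) ≤
      ENNReal.ofReal (m : ℝ)⁻¹ := by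
  calc _ ≤ ∫⁻ x in slabIndex i s m ⁻¹' {j}, ENNReal.ofReal (m : ℝ)⁻¹ *
        ENNReal.ofReal (φ (x - EuclideanSpace.single i (j * s))) := by
        refine setLIntegral_mono' (measurable_slabIndex (measurableSet_singleton j))
          fun x hx => ?_
        rw [ofReal_translateMixture hφ0, Finset.sum_eq_single j]
        · intro l _ hl
          by_contra h
          refine hl ((slabIndex_eq has (hφa _ fun h0 => h ?_)).symm.trans hx)
          rw [h0, ENNReal.ofReal_zero]
        · simp
    _ ≤ ∫⁻ x, ENNReal.ofReal (m : ℝ)⁻¹ *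
        ENNReal.ofReal (φ (x - EuclideanSpace.single i (j * s))) := setLIntegral_le_lintegral _ _
    _ = _ := by
      rw [lintegral_const_mul' _ _ ENNReal.ofReal_ne_top,
        lintegral_sub_right_eq_self (fun x => ENNReal.ofReal (φ x)), hφ1, mul_one]

theorem le_norm_sub_of_slabIndex_ne [NeZero m] {a b : ℝ} (hb : 0 ≤ b) (has : 2 * a + b ≤ s)
    (hφ0 : ∀ x, 0 ≤ φ x) (hφa : ∀ x, φ x ≠ 0 → |x i| < a) {x y : Feat d}
    (hx : x ∈ Function.support (translateMixture i s m φ))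
    (hy : y ∈ Function.support (translateMixture i s m φ))
    (hxy : slabIndex i s m x ≠ slabIndex i s m y) : b ≤ ‖x - y‖ := by
  obtain ⟨j, hj⟩ := (translateMixture_ne_zero_iff (NeZero.ne m) hφ0 x).1 hx
  obtain ⟨l, hl⟩ := (translateMixture_ne_zero_iff (NeZero.ne m) hφ0 y).1 hy
  have hj := hφa _ hj
  have hl := hφa _ hl
  rw [slabIndex_eq (by linarith) hj, slabIndex_eq (by linarith) hl] at hxy
  refine le_trans ?_ (PiLp.norm_apply_le (x - y) i)
  have ha : 0 < a := (abs_nonneg _).trans_lt hj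
  simp only [PiLp.sub_apply, PiLp.single_apply, if_true] at hj hl ⊢
  rw [Real.norm_eq_abs]
  have h1 : s ≤ |(j : ℝ) * s - l * s| := by
    rw [← sub_mul, abs_mul, abs_of_pos (by linarith : 0 < s)]
    refine le_mul_of_one_le_left (by linarith) ?_
    have : (1 : ℤ) ≤ |((j : ℕ) : ℤ) - ((l : ℕ) : ℤ)| :=
      Int.one_le_abs (sub_ne_zero.2 fun h => hxy (Fin.ext (by exact_mod_cast h)))
    exact_mod_cast this
  have h2 : |(j : ℝ) * s - l * s| ≤ |x i - y i| + |x i - j * s| + |y i - l * s| := by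
    have e : (j : ℝ) * s - l * s = (x i - y i) - (x i - j * s) + (y i - l * s) := by ring
    rw [e]
    exact (abs_add_le _ _).trans (add_le_add_left (abs_sub _ _) _)
  linarith

/-- For every rule of sample size `n`, the uniform mixture of `m` separated bumps can be labelled so
that the rule has excess risk at least `(1 - n / m) / 2`. -/
theorem exists_law_translateMixture_le_excessRisk [NeZero m] {L α a : ℝ} (hL : 0 < L) (hα : 0 < α)
    (has : 2 * a + 1 / L ≤ s) (hφ : Measurable φ) (hφ0 : ∀ x, 0 ≤ φ x)
    (hφo : IsOpen (Function.support φ)) (hφ1 : ∫⁻ x, ENNReal.ofReal (φ x) = 1)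
    (hφa : ∀ x, φ x ≠ 0 → |x i| < a) {n : ℕ} (Φ : DiscRule d n) :
    ∃ P : ClassLaw d, P.μ = translateMixture i s m φ ∧ P.IsSmooth L ∧ P.HasMargin α (2 ^ α) ∧
      (1 - n * (m : ℝ)⁻¹) / 2 ≤ P.excessRisk Φ.toFun := by
  have hL' : 0 < 1 / L := by positivity
  have hm : m ≠ 0 := NeZero.ne m
  have h1 := lintegral_translateMixture (i := i) (s := s) hm hφ hφ0 hφ1
  have hk : Measurable (slabIndex i s m) := measurable_slabIndex
  let ν : Measure (Feat d) := volume.withDensity fun x =>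
    ENNReal.ofReal (translateMixture i s m φ x)
  have : IsProbabilityMeasure ν :=
    ⟨by rw [withDensity_apply _ MeasurableSet.univ, setLIntegral_univ, h1]⟩
  obtain ⟨σ, hσ⟩ := exists_labelling_le_error ν hk (p := (m : ℝ)⁻¹) (fun j => by
    refine ENNReal.toReal_le_of_le_ofReal (by positivity) ?_
    rw [withDensity_apply _ (hk (measurableSet_singleton j))]
    exact setLIntegral_translateMixture_le (by linarith) hφ0 hφ1 hφa j) Φ.measurable
  refine ⟨ClassLaw.ofLabelling _ (measurable_translateMixture hφ) (translateMixture_nonneg hφ0)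
    (isOpen_support_translateMixture hm hφ0 hφo) h1 _ hk σ, rfl,
    ClassLaw.isSmooth_ofLabelling hL fun x hx y hy hxy =>
      le_norm_sub_of_slabIndex_ne hL'.le has hφ0 hφa hx hy hxy,
    ClassLaw.hasMargin_ofLabelling hα, ?_⟩
  rw [ClassLaw.excessRisk, ClassLaw.bayesRisk_ofLabelling,
    ClassLaw.risk_ofLabelling Φ.measurable, sub_zero]
  exact hσ

end Mixture

/-- For a sample of size `n`, enough bumps push the excess risk above any level below `1 / 2`. -/
theorem exists_pos_le_half_one_sub (n : ℕ) {ε : ℝ} (hε : ε < 1 / 2) :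
    ∃ m : ℕ, m ≠ 0 ∧ ε ≤ (1 - n * (m : ℝ)⁻¹) / 2 := by
  obtain ⟨m, hm⟩ := exists_nat_gt (n / (1 - 2 * ε))
  have hm0 : (0 : ℝ) < m := lt_of_le_of_lt (div_nonneg (by positivity) (by linarith)) hm
  refine ⟨m, by exact_mod_cast hm0.ne', ?_⟩
  rw [div_lt_iff₀ (by linarith)] at hm
  have : n * (m : ℝ)⁻¹ ≤ 1 - 2 * ε := by
    rw [← div_eq_mul_inv, div_le_iff₀ hm0]; linarith
  linarith

/-! ### Minimal mass -/

/-- If the average of the density over each pair of points symmetric about `x` is at least `c` times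
its value at `x`, so is its average over a ball centred at `x`. -/
theorem mul_volume_le_setIntegral_ball {f : Feat d → ℝ} (hf : Integrable f) {c δ : ℝ} (hδ : 0 < δ)
    {x : Feat d} (h : ∀ y ∈ Metric.ball (0 : Feat d) δ, 2 * (c * f x) ≤ f (x + y) + f (x - y)) :
    c * (volume : Measure (Feat d)).real (Metric.ball 0 1) * f x * δ ^ d ≤
      ∫ y in Metric.ball x δ, f y := by
  classical
  have hadd : ∫ y in Metric.ball (0 : Feat d) δ, f (x + y) = ∫ y in Metric.ball x δ, f y := by
    rw [← integral_indicator measurableSet_ball, ← integral_indicator measurableSet_ball,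
      ← integral_add_left_eq_self ((Metric.ball x δ).indicator f) x]
    refine integral_congr_ae (.of_forall fun y => ?_)
    simp [Set.indicator_apply, dist_eq_norm]
  have hsub : ∫ y in Metric.ball (0 : Feat d) δ, f (x - y) = ∫ y in Metric.ball x δ, f y := by
    rw [← integral_indicator measurableSet_ball, ← integral_indicator measurableSet_ball,
      ← integral_sub_left_eq_self ((Metric.ball x δ).indicator f) volume x]
    refine integral_congr_ae (.of_forall fun y => ?_)
    simp [Set.indicator_apply, dist_eq_norm]
  have h1 : ∫ _y in Metric.ball (0 : Feat d) δ, 2 * (c * f x) ≤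
      ∫ y in Metric.ball (0 : Feat d) δ, (f (x + y) + f (x - y)) :=
    setIntegral_mono_on (integrableOn_const measure_ball_lt_top.ne)
      ((hf.comp_add_left x).integrableOn.add (hf.comp_sub_left x).integrableOn)
      measurableSet_ball h
  rw [integral_add (hf.comp_add_left x).integrableOn (hf.comp_sub_left x).integrableOn, hadd, hsub,
    setIntegral_const, Measure.real, Measure.addHaar_ball_of_pos _ _ hδ, smul_eq_mul] at h1
  simp only [finrank_euclideanSpace, Fintype.card_fin, ENNReal.toReal_mul,
    ENNReal.toReal_ofReal (pow_nonneg hδ.le d)] at h1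
  rw [Measure.real]
  linarith

/-- The cosine of the `i`-th coordinate, cut off outside `(-π / 2, π / 2)`, with an integrable weight
that varies slowly. It is positive on an open slab and is not normalized. -/
noncomputable def cosBump (i : Fin d) (x : Feat d) : ℝ :=
  (if |x i| < Real.pi / 2 then Real.cos (x i) else 0) * (1 + ‖x‖) ^ (-((d : ℝ) + 1))

theorem ite_cos_nonneg (u : ℝ) : 0 ≤ if |u| < Real.pi / 2 then Real.cos u else 0 := by
  split_ifs with h
  · exact (Real.cos_pos_of_mem_Ioo (abs_lt.1 h)).le
  · exact le_rfl

/-- The addition formula `cos (t + s) + cos (t - s) = 2 cos s cos t` becomes an inequality when the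
cosine is cut off outside `(-π / 2, π / 2)`, since `t + s` and `t - s` stay in `[-π, π]`, where only
negative values are cut off. -/
theorem two_mul_cos_mul_le_add {t s : ℝ} (hs : |s| ≤ Real.pi / 2) :
    2 * (Real.cos s * (if |t| < Real.pi / 2 then Real.cos t else 0)) ≤
      (if |t + s| < Real.pi / 2 then Real.cos (t + s) else 0) +
      (if |t - s| < Real.pi / 2 then Real.cos (t - s) else 0) := by
  by_cases ht : |t| < Real.pi / 2
  · have hle : ∀ u : ℝ, |u| ≤ Real.pi → Real.cos u ≤ if |u| < Real.pi / 2 then Real.cos u else 0 := by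
      intro u hu
      split_ifs with h
      · exact le_rfl
      · rw [← Real.cos_abs]
        exact Real.cos_nonpos_of_pi_div_two_le_of_le (not_lt.1 h) (by linarith [Real.pi_pos])
    rw [if_pos ht]
    have h1 := hle (t + s) ((abs_add_le _ _).trans (by linarith))
    have h2 := hle (t - s) ((abs_sub _ _).trans (by linarith))
    have h3 : Real.cos (t + s) + Real.cos (t - s) = 2 * (Real.cos s * Real.cos t) := by
      rw [Real.cos_add, Real.cos_sub]; ring
    linarith
  · rw [if_neg ht]
    linarith [ite_cos_nonneg (t + s), ite_cos_nonneg (t - s)]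

section CosBump

variable (i : Fin d)

theorem cosBump_nonneg (x : Feat d) : 0 ≤ cosBump i x :=
  mul_nonneg (ite_cos_nonneg _) (by positivity)

theorem support_cosBump : Function.support (cosBump i) = {x | |x i| < Real.pi / 2} := by
  ext x
  have h1 : (1 + ‖x‖) ^ (-((d : ℝ) + 1)) ≠ 0 := by positivity
  by_cases h : |x i| < Real.pi / 2
  · simpa [cosBump, h, (Real.cos_pos_of_mem_Ioo (abs_lt.1 h)).ne'] using h1
  · simp [cosBump, h]

theorem isOpen_support_cosBump : IsOpen (Function.support (cosBump i)) := by
  rw [support_cosBump]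
  exact isOpen_lt (EuclideanSpace.proj (𝕜 := ℝ) i).continuous.abs continuous_const

theorem measurable_cosBump : Measurable (cosBump i) := by
  have hi : Measurable fun x : Feat d => x i :=
    (EuclideanSpace.proj (𝕜 := ℝ) i).continuous.measurable
  refine Measurable.mul (Measurable.ite ?_ (Real.measurable_cos.comp hi) measurable_const)
    (by fun_prop)
  exact measurableSet_lt (by fun_prop) measurable_const

-- The exponent `d + 1` exceeds the dimension, so the weight is integrable.
theorem integrable_cosBump : Integrable (cosBump i) := by
  have h : Integrable fun x : Feat d => (1 + ‖x‖) ^ (-((d : ℝ) + 1)) :=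
    integrable_one_add_norm (by simp)
  refine h.mono' (measurable_cosBump i).aestronglyMeasurable (.of_forall fun x => ?_)
  rw [Real.norm_of_nonneg (cosBump_nonneg i x)]
  refine mul_le_of_le_one_left (by positivity) ?_
  split_ifs
  · exact Real.cos_le_one _
  · exact zero_le_one

theorem integral_cosBump_pos : 0 < ∫ x, cosBump i x := by
  rw [integral_pos_iff_support_of_nonneg (cosBump_nonneg i) (integrable_cosBump i)]
  refine (isOpen_support_cosBump i).measure_pos _ ⟨0, ?_⟩
  rw [support_cosBump]
  simp [Real.pi_pos]

theorem two_mul_cosBump_le_add {δ : ℝ} (hδ : δ ≤ Real.pi / 2) (x : Feat d) {y : Feat d}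
    (hy : ‖y‖ < δ) :
    2 * (Real.cos δ * (1 + δ) ^ (-((d : ℝ) + 1)) * cosBump i x) ≤
      cosBump i (x + y) + cosBump i (x - y) := by
  have hyi : |y i| ≤ δ := (PiLp.norm_apply_le y i).trans hy.le
  have hδ0 : 0 < δ := (norm_nonneg _).trans_lt hy
  -- The weight changes by a factor of at most `1 + δ`, to the power `d + 1`, since
  -- `1 + ‖x‖ + ‖y‖ ≤ (1 + δ) * (1 + ‖x‖)`.
  have hw : ∀ z : Feat d, ‖z‖ ≤ ‖x‖ + ‖y‖ →
      (1 + δ) ^ (-((d : ℝ) + 1)) * (1 + ‖x‖) ^ (-((d : ℝ) + 1)) ≤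
        (1 + ‖z‖) ^ (-((d : ℝ) + 1)) := by
    intro z hz
    rw [← Real.mul_rpow (by positivity) (by positivity)]
    refine Real.rpow_le_rpow_of_nonpos (by positivity) ?_ (by linarith [d.cast_nonneg (α := ℝ)])
    nlinarith [norm_nonneg x]
  have hcos : Real.cos δ ≤ Real.cos (y i) := by
    rw [← Real.cos_abs (y i)]
    exact Real.cos_le_cos_of_nonneg_of_le_pi (abs_nonneg _) (by linarith [Real.pi_pos]) hyi
  have h1 := two_mul_cos_mul_le_add (t := x i) (hyi.trans hδ)
  have h2 := mul_le_mul_of_nonneg_right hcos (ite_cos_nonneg (x i))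
  have hp := mul_le_mul_of_nonneg_left (hw _ (norm_add_le x y)) (ite_cos_nonneg ((x + y) i))
  have hq := mul_le_mul_of_nonneg_left (hw _ (norm_sub_le x y)) (ite_cos_nonneg ((x - y) i))
  simp only [cosBump]
  refine le_trans ?_ (add_le_add hp hq)
  rw [← add_mul]
  simp only [PiLp.add_apply, PiLp.sub_apply]
  have hW : 0 ≤ (1 + δ) ^ (-((d : ℝ) + 1)) * (1 + ‖x‖) ^ (-((d : ℝ) + 1)) := by positivity
  have h3 := mul_le_mul_of_nonneg_right (le_trans (by linarith) h1 :
    2 * (Real.cos δ * (if |x i| < Real.pi / 2 then Real.cos (x i) else 0)) ≤ _) hW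
  refine le_trans (le_of_eq ?_) h3
  ring

end CosBump

/-- For every `κ` below the volume of the unit ball, the mixtures of translates of the normalized
`cosBump` have minimal mass constant `κ` up to a radius that depends neither on the number of
translates nor on their spacing. -/
theorem exists_hasMinimalMass_translateMixture_cosBump (i : Fin d) {κ : ℝ}
    (hκ : κ < (volume : Measure (Feat d)).real (Metric.ball 0 1)) :
    ∃ δ₀ > 0, ∀ (s : ℝ) (m : ℕ) (P : ClassLaw d),
      P.μ = translateMixture i s m (fun x => (∫ y, cosBump i y)⁻¹ * cosBump i x) →
      P.HasMinimalMass κ δ₀ := by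
  set γ := (volume : Measure (Feat d)).real (Metric.ball 0 1) with hγ
  set r : ℝ := -((d : ℝ) + 1)
  have hev : ∀ᶠ δ : ℝ in nhds 0, κ < Real.cos δ * (1 + δ) ^ r * γ ∧ δ < Real.pi / 2 := by
    have hc : ContinuousAt (fun δ : ℝ => Real.cos δ * (1 + δ) ^ r * γ) 0 :=
      ((Real.continuous_cos.continuousAt).mul ((continuousAt_const.add continuousAt_id).rpow_const
        (Or.inl (by simp)))).mul continuousAt_const
    exact (hc.eventually_const_lt (by simpa using hκ)).and
      (eventually_lt_nhds (by linarith [Real.pi_pos]))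
  obtain ⟨ρ, hρ, hball⟩ := Metric.eventually_nhds_iff.1 hev
  refine ⟨ρ / 2, by positivity, fun s m P hP δ hδ hδρ x _ => ?_⟩
  obtain ⟨h1, h2⟩ := hball (y := δ) (by rw [Real.dist_eq, sub_zero, abs_of_pos hδ]; linarith)
  set f : Feat d → ℝ := P.μ
  have hint : Integrable f := by
    rw [hP]
    exact (integrable_finsetSum _ fun j _ =>
      ((integrable_cosBump i).const_mul _).comp_sub_right _).const_mul _
  -- The inequality for symmetric pairs is linear and translation invariant, hence passes from one
  -- bump to the mixture, whatever `s` and `m`.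
  have hpair : ∀ y ∈ Metric.ball (0 : Feat d) δ,
      2 * (Real.cos δ * (1 + δ) ^ r * f x) ≤ f (x + y) + f (x - y) := by
    intro y hy
    rw [mem_ball_zero_iff] at hy
    have e1 : 2 * (Real.cos δ * (1 + δ) ^ r * f x) = (m : ℝ)⁻¹ * ∑ j : Fin m,
        (∫ y, cosBump i y)⁻¹ * (2 * (Real.cos δ * (1 + δ) ^ r *
          cosBump i (x - EuclideanSpace.single i (j * s)))) := by
      simp only [hP, translateMixture, ← Finset.mul_sum]
      ring
    have e2 : f (x + y) + f (x - y) = (m : ℝ)⁻¹ * ∑ j : Fin m,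
        (∫ y, cosBump i y)⁻¹ * (cosBump i (x - EuclideanSpace.single i (j * s) + y) +
          cosBump i (x - EuclideanSpace.single i (j * s) - y)) := by
      simp only [hP, translateMixture, ← mul_add, ← Finset.sum_add_distrib, sub_add_eq_add_sub,
        sub_right_comm _ _ y]
    rw [e1, e2]
    have := integral_cosBump_pos i
    gcongr with j
    exact two_mul_cosBump_le_add i h2.le _ hy
  have hmass : P.lawX.real (Metric.ball x δ) = ∫ y in Metric.ball x δ, f y := by
    rw [Measure.real, P.lawX_apply measurableSet_ball,
      integral_eq_lintegral_of_nonneg_ae (.of_forall P.μ_nonneg)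
        P.μ_measurable.aestronglyMeasurable]
  rw [hmass]
  refine le_trans ?_ (mul_volume_le_setIntegral_ball hint hδ hpair)
  have := P.μ_nonneg x
  rw [← hγ]
  gcongr

/-! ### Tail -/

/-- A density that is nowhere in `(0, ε₀)` has no mass where it is below `ε₀`. -/
theorem ClassLaw.hasTail_id_of_forall_le {P : ClassLaw d} {ε₀ : ℝ}
    (h : ∀ x ∈ P.Ω, ε₀ ≤ P.μ x) : P.HasTail id ε₀ := by
  intro ε hε hε₀
  have : P.lawX {x | P.μ x < ε} = 0 := by
    have hms : MeasurableSet {x | P.μ x < ε} := measurableSet_lt P.μ_measurable measurable_const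
    rw [P.lawX_apply hms, setLIntegral_eq_zero hms]
    intro x hx
    have hx0 : P.μ x = 0 := by
      by_contra h0
      exact absurd (h x h0) (not_le.2 (lt_trans hx hε₀))
    simp [hx0]
  rw [Measure.real, this]
  exact hε.le

/-- The uniform density on the ball of radius `1 / m` centred at the origin. -/
noncomputable def ballDensity (d m : ℕ) : Feat d → ℝ :=
  (Metric.ball (0 : Feat d) (m : ℝ)⁻¹).indicator
    fun _ => ((volume : Measure (Feat d)).real (Metric.ball 0 (m : ℝ)⁻¹))⁻¹

theorem volume_real_ball_inv (d : ℕ) {m : ℕ} (hm : m ≠ 0) :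
    (volume : Measure (Feat d)).real (Metric.ball 0 (m : ℝ)⁻¹) =
      ((m : ℝ) ^ d)⁻¹ * (volume : Measure (Feat d)).real (Metric.ball 0 1) := by
  rw [Measure.real, Measure.addHaar_ball_of_pos _ _ (by positivity)]
  simp [Measure.real, ENNReal.toReal_ofReal]

theorem volume_real_ball_pos (d : ℕ) {r : ℝ} (hr : 0 < r) :
    0 < (volume : Measure (Feat d)).real (Metric.ball 0 r) :=
  ENNReal.toReal_pos (Metric.measure_ball_pos _ _ hr).ne' measure_ball_lt_top.ne

theorem ballDensity_nonneg (d m : ℕ) (x : Feat d) : 0 ≤ ballDensity d m x :=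
  Set.indicator_nonneg (fun _ _ => by positivity) _

theorem support_ballDensity (d : ℕ) {m : ℕ} (hm : m ≠ 0) :
    Function.support (ballDensity d m) = Metric.ball 0 (m : ℝ)⁻¹ := by
  have := volume_real_ball_pos d (r := (m : ℝ)⁻¹) (by positivity)
  rw [ballDensity, Set.support_indicator, Function.support_const (by positivity),
    Set.inter_univ]

theorem lintegral_ballDensity (d : ℕ) {m : ℕ} (hm : m ≠ 0) :
    ∫⁻ x, ENNReal.ofReal (ballDensity d m x) = 1 := by
  have hpos := volume_real_ball_pos d (r := (m : ℝ)⁻¹) (by positivity)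
  have : (fun x => ENNReal.ofReal (ballDensity d m x)) =
      (Metric.ball (0 : Feat d) (m : ℝ)⁻¹).indicator fun _ =>
        ENNReal.ofReal ((volume : Measure (Feat d)).real (Metric.ball 0 (m : ℝ)⁻¹))⁻¹ := by
    ext x
    by_cases hx : x ∈ Metric.ball (0 : Feat d) (m : ℝ)⁻¹ <;> simp [ballDensity, hx]
  rw [this, lintegral_indicator_const measurableSet_ball, ENNReal.ofReal_inv_of_pos hpos,
    Measure.real, ENNReal.ofReal_toReal measure_ball_lt_top.ne]
  exact ENNReal.inv_mul_cancel (Metric.measure_ball_pos _ _ (by positivity)).ne'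
    measure_ball_lt_top.ne

/-- `m` balls of radius `1 / m`, each of mass `1 / m`, have density at least that of a single ball of
radius `1`, in every dimension `d ≥ 1`. -/
theorem le_translateMixture_ballDensity (hd : 1 ≤ d) (i : Fin d) (s : ℝ) {m : ℕ} (hm : m ≠ 0)
    {x : Feat d} (hx : translateMixture i s m (ballDensity d m) x ≠ 0) :
    ((volume : Measure (Feat d)).real (Metric.ball 0 1))⁻¹ ≤
      translateMixture i s m (ballDensity d m) x := by
  obtain ⟨j, hj⟩ := (translateMixture_ne_zero_iff hm (ballDensity_nonneg d m) x).1 hx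
  have hj' : x - EuclideanSpace.single i (j * s) ∈ Metric.ball (0 : Feat d) (m : ℝ)⁻¹ := by
    rw [← support_ballDensity d hm]; exact hj
  have hγ := volume_real_ball_pos d one_pos
  calc ((volume : Measure (Feat d)).real (Metric.ball 0 1))⁻¹
      ≤ (m : ℝ)⁻¹ * ballDensity d m (x - EuclideanSpace.single i (j * s)) := by
        rw [ballDensity, Set.indicator_of_mem hj', volume_real_ball_inv d hm, mul_inv, inv_inv,
          ← mul_assoc]
        refine le_mul_of_one_le_left (by positivity) ?_
        have h1 : (1 : ℝ) ≤ m := by exact_mod_cast Nat.one_le_iff_ne_zero.2 hm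
        rw [← div_eq_inv_mul, one_le_div (by positivity)]
        exact le_self_pow₀ h1 (by omega)
    _ ≤ _ := by
        rw [translateMixture]
        gcongr
        exact Finset.single_le_sum (f := fun j : Fin m =>
          ballDensity d m (x - EuclideanSpace.single i (j * s)))
          (fun _ _ => ballDensity_nonneg d m _) (Finset.mem_univ j)

/-! ### Lower bounds over the classes -/

/-- A class of laws on which every rule, whatever its sample size, has excess risk at least a fixed
`ε > 0` for some law admits no uniformly consistent sequence of rules. -/
theorem not_uniformlyConsistent_of_forall_exists {S : Set (ClassLaw d)} {ε : ℝ} (hε : 0 < ε)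
    (h : ∀ (n : ℕ) (Φ : DiscRule d n), ∃ P ∈ S, ε ≤ P.excessRisk Φ.toFun)
    (Φ : ∀ n : ℕ, DiscRule d n) : ¬ UniformlyConsistent S Φ := by
  intro hc
  obtain ⟨N, hN⟩ := hc ε hε
  obtain ⟨P, hP, hle⟩ := h N (Φ N)
  exact absurd (hN N le_rfl P hP) (not_lt.2 hle)

theorem mainTheorem4 (d : ℕ) (hd : 1 ≤ d) (L α : ℝ) (hL : 0 < L) (hα : 0 < α) :
    (∀ κ : ℝ, 0 < κ → κ < (volume : Measure (Feat d)).real (Metric.ball 0 1) →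
      ∃ C > 0, ∃ δ₀ > 0,
        (∀ (n : ℕ) (Φ : DiscRule d n) (ε : ℝ), ε < (4 : ℝ) ^ (-α) → ε < 1 / 2 →
          ∃ P ∈ smoothMarginClass d L α ∩ minimalMassClass d κ,
            P.HasMargin α C ∧ P.HasMinimalMass κ δ₀ ∧ ε ≤ P.excessRisk Φ.toFun) ∧
        ∀ Φ : ∀ n : ℕ, DiscRule d n,
          ¬ UniformlyConsistent {P ∈ smoothMarginClass d L α ∩ minimalMassClass d κ |
            P.HasMargin α C ∧ P.HasMinimalMass κ δ₀} Φ) ∧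
    (∃ C > 0, ∃ ε₀ > 0,
      (∀ (n : ℕ) (Φ : DiscRule d n) (ε : ℝ), ε < (4 : ℝ) ^ (-α) → ε < 1 / 2 →
        ∃ P ∈ smoothMarginClass d L α ∩ tailClass d id,
          P.HasMargin α C ∧ P.HasTail id ε₀ ∧ ε ≤ P.excessRisk Φ.toFun) ∧
      ∀ Φ : ∀ n : ℕ, DiscRule d n,
        ¬ UniformlyConsistent {P ∈ smoothMarginClass d L α ∩ tailClass d id |
          P.HasMargin α C ∧ P.HasTail id ε₀} Φ) := by
  let i : Fin d := ⟨0, hd⟩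
  have hC : (0 : ℝ) < 2 ^ α := by positivity
  constructor
  · intro κ _ hκ
    obtain ⟨δ₀, hδ₀, hmma⟩ := exists_hasMinimalMass_translateMixture_cosBump i hκ
    have key : ∀ (n : ℕ) (Φ : DiscRule d n) (ε : ℝ), ε < 1 / 2 →
        ∃ P ∈ smoothMarginClass d L α ∩ minimalMassClass d κ,
          P.HasMargin α (2 ^ α) ∧ P.HasMinimalMass κ δ₀ ∧ ε ≤ P.excessRisk Φ.toFun := by
      intro n Φ ε hε
      obtain ⟨m, hm, hle⟩ := exists_pos_le_half_one_sub n hε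
      have : NeZero m := ⟨hm⟩
      have hI := integral_cosBump_pos i
      have hsupp : Function.support (fun x => (∫ y, cosBump i y)⁻¹ * cosBump i x) =
          {x | |x i| < Real.pi / 2} := by
        rw [← support_cosBump]
        ext x
        simp [hI.ne']
      obtain ⟨P, hμ, hsm, hmar, hrisk⟩ := exists_law_translateMixture_le_excessRisk (m := m)
        (i := i) (φ := fun x => (∫ y, cosBump i y)⁻¹ * cosBump i x) hL hα
        (le_refl (2 * (Real.pi / 2) + 1 / L)) ((measurable_cosBump i).const_mul _)
        (fun x => mul_nonneg (inv_nonneg.2 hI.le) (cosBump_nonneg i x))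
        (by rw [hsupp, ← support_cosBump]; exact isOpen_support_cosBump i)
        (by
          rw [← ofReal_integral_eq_lintegral_ofReal ((integrable_cosBump i).const_mul _)
            (.of_forall fun x => mul_nonneg (inv_nonneg.2 hI.le) (cosBump_nonneg i x)),
            integral_const_mul, inv_mul_cancel₀ hI.ne', ENNReal.ofReal_one])
        (fun x hx => by
          have : x ∈ {x : Feat d | |x i| < Real.pi / 2} := hsupp ▸ hx
          exact this) Φ
      have hmm := hmma _ m P hμ
      exact ⟨P, ⟨⟨hsm, _, hC, hmar⟩, _, hδ₀, hmm⟩, hmar, hmm, hle.trans hrisk⟩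
    -- `1 / 4` stands for any positive level below `1 / 2`.
    refine ⟨2 ^ α, hC, δ₀, hδ₀, fun n Φ ε _ hε => key n Φ ε hε,
      not_uniformlyConsistent_of_forall_exists (ε := 1 / 4) (by norm_num) fun n Φ => ?_⟩
    obtain ⟨P, hP, hmar, hmm, hle⟩ := key n Φ (1 / 4) (by norm_num)
    exact ⟨P, ⟨hP, hmar, hmm⟩, hle⟩
  · have hγ := inv_pos.2 (volume_real_ball_pos d one_pos)
    have key : ∀ (n : ℕ) (Φ : DiscRule d n) (ε : ℝ), ε < 1 / 2 →
        ∃ P ∈ smoothMarginClass d L α ∩ tailClass d id, P.HasMargin α (2 ^ α) ∧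
          P.HasTail id ((volume : Measure (Feat d)).real (Metric.ball 0 1))⁻¹ ∧
          ε ≤ P.excessRisk Φ.toFun := by
      intro n Φ ε hε
      obtain ⟨m, hm, hle⟩ := exists_pos_le_half_one_sub n hε
      have : NeZero m := ⟨hm⟩
      obtain ⟨P, hμ, hsm, hmar, hrisk⟩ := exists_law_translateMixture_le_excessRisk (m := m)
        (i := i) (φ := ballDensity d m) hL hα (le_refl (2 * (m : ℝ)⁻¹ + 1 / L))
        (measurable_const.indicator measurableSet_ball) (ballDensity_nonneg d m)
        (by rw [support_ballDensity d hm]; exact Metric.isOpen_ball) (lintegral_ballDensity d hm)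
        (fun x hx => by
          have hx' : x ∈ Metric.ball (0 : Feat d) (m : ℝ)⁻¹ := support_ballDensity d hm ▸ hx
          exact (PiLp.norm_apply_le x i).trans_lt (mem_ball_zero_iff.1 hx')) Φ
      have ht : P.HasTail id ((volume : Measure (Feat d)).real (Metric.ball 0 1))⁻¹ :=
        ClassLaw.hasTail_id_of_forall_le fun x hx => by
          have hx' : P.μ x ≠ 0 := hx
          rw [hμ] at hx' ⊢
          exact le_translateMixture_ballDensity hd i _ hm hx'
      exact ⟨P, ⟨⟨hsm, _, hC, hmar⟩, _, hγ, ht⟩, hmar, ht, hle.trans hrisk⟩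
    refine ⟨2 ^ α, hC, _, hγ, fun n Φ ε _ hε => key n Φ ε hε,
      not_uniformlyConsistent_of_forall_exists (ε := 1 / 4) (by norm_num) fun n Φ => ?_⟩
    obtain ⟨P, hP, hmar, ht, hle⟩ := key n Φ (1 / 4) (by norm_num)
    exact ⟨P, ⟨hP, hmar, ht⟩, hle⟩
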